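/- Let $N=\{N(t)\}_{t\ge 0}$ be a Poisson process of rate $\lambda>0$ (with nondecreasing right-continuous paths), let $X_1,X_2,\dots$ be i.i.d. real random variables such that the sequence $(X_k)_{k\ge1}$ is independent of $N$, and let $$Z(t)=\sum_{k=1}^{N(t)}X_k,\qquad t\ge 0,$$ be the corresponding compound Poisson process. Let $U_1,U_2,\dots$ be i.i.d. random variables, uniformly distributed on $(0,1)$, such that the sequence $(U_k)_{k\ge1}$ is independent of the pair $\bigl(N,(X_k)_{k\ge1}\bigr)$. Then almost surely the path $s\mapsto Z(s)$ is Riemann integrable on $[0,t]$ for every $t\ge0$, and for every fixed $t\ge 0$ the Riemann integral $Y(t)$ of $Z$ satisfies $$Y(t)=\int_0^t Z(s)\,\mathrm{d}s\ \stackrel{d}{=}\ t\sum_{k=1}^{N(t)}X_kU_k ,$$ that is, the two real random variables have the same law. -/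

import Mathlib

open MeasureTheory ProbabilityTheory
open scoped NNReal

noncomputable section

/-- `N` is a homogeneous Poisson process of rate `rate` on the time set `[0, ∞)`: it starts at `0`,
has independent increments, the increment over `(s, t]` has the Poisson law of parameter
`rate * (t - s)`, and almost all paths are nondecreasing and right-continuous (for the discrete
topology of `ℕ`). Increments are taken in `ℝ`, not with truncated subtraction. -/
structure IsPoissonProcess {Ω : Type*} [MeasurableSpace Ω] (N : ℝ≥0 → Ω → ℕ) (rate : ℝ≥0)
    (P : Measure Ω) : Prop where
  measurable : ∀ t, Measurable (N t)
  start_zero : ∀ᵐ ω ∂P, N 0 ω = 0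
  indep_increments : HasIndepIncrements (fun (t : ℝ≥0) (ω : Ω) => (N t ω : ℝ)) P
  law_increments : ∀ s t : ℝ≥0, s ≤ t →
    HasLaw (fun ω => (N t ω : ℝ) - (N s ω : ℝ))
      ((poissonMeasure (rate * (t - s))).map (Nat.cast : ℕ → ℝ)) P
  paths : ∀ᵐ ω ∂P, Monotone (fun t => N t ω) ∧
    ∀ t, ContinuousWithinAt (fun s => N s ω) (Set.Ici t) t

/-- The sum of the first `N t` terms of the sequence `X 0, X 1, …` (the terms that are written
`X₁, X₂, …` when one counts from `1`). -/
def compoundSum {Ω : Type*} (N : ℝ≥0 → Ω → ℕ) (X : ℕ → Ω → ℝ) (t : ℝ≥0) (ω : Ω) : ℝ :=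
  ∑ k ∈ Finset.range (N t ω), X k ω

/-- `f` is Riemann integrable on `[a, b]` with Riemann integral `I`: the Riemann sums over the
tagged partitions `a = x 0 ≤ … ≤ x n = b` with tags `ξ i ∈ [x i, x (i + 1)]` tend to `I` as the
mesh tends to zero. -/
def HasRiemannIntegral (f : ℝ → ℝ) (a b I : ℝ) : Prop :=
  a ≤ b ∧ ∀ ε > 0, ∃ δ > 0, ∀ (n : ℕ) (x ξ : ℕ → ℝ), x 0 = a → x n = b →
    (∀ i < n, x i ≤ ξ i ∧ ξ i ≤ x (i + 1) ∧ x (i + 1) - x i < δ) →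
    |∑ i ∈ Finset.range n, f (ξ i) * (x (i + 1) - x i) - I| < ε

end

/-! Both laws are identified by their characteristic functions. Let `φ` be that of a jump. A
right-tagged uniform Riemann sum of `Z` on `[0, t]` becomes, by Abel summation
(`sum_range_mul_sub_eq`), a sum of increments of `Z` with weights `t - s_j`. Freezing the path of
`N`, the jumps in distinct blocks are independent, so averaging over `N` gives `∏ exp(λ (s_{j+1} -
s_j) (φ(u (t - s_j)) - 1))`. Refining the partition gives `exp(λ ∫₀ᵗ (φ(u (t - s)) - 1) ds)` for the
integral.

On the other side, integrating out `U`, then `X`, then `N t` gives `exp(λ t (E φ(u t U) - 1))`, and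
the substitution `s = t - t v` matches the exponents.

Pathwise integrability holds because splitting jumps into positive and negative parts makes each
path a difference of two monotone functions. -/

section

open Filter Topology

/-! ### Riemann sums -/

/-- A monotone function is Riemann integrable on every compact interval. -/
theorem hasRiemannIntegral_of_monotone {f : ℝ → ℝ} (hf : Monotone f) {a b : ℝ} (hab : a ≤ b) :
    HasRiemannIntegral f a b (∫ x in a..b, f x) := by
  refine ⟨hab, fun ε hε => ?_⟩
  have hfab : 0 ≤ f b - f a := sub_nonneg.2 (hf hab)
  -- The oscillations of `f` over the cells telescope, so the error is at most `(f b - f a) * δ`;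
  -- the `+ 1` covers constant `f`.
  refine ⟨ε / (f b - f a + 1), by positivity, fun n x ξ h0 hn h => ?_⟩
  have hint : ∀ c d : ℝ, IntervalIntegrable f volume c d := fun c d => hf.intervalIntegrable
  have hsum : ∫ y in a..b, f y = ∑ i ∈ Finset.range n, ∫ y in x i..x (i + 1), f y := by
    rw [intervalIntegral.sum_integral_adjacent_intervals fun k _ => hint _ _, h0, hn]
  have hstep : ∀ i ∈ Finset.range n,
      |f (ξ i) * (x (i + 1) - x i) - ∫ y in x i..x (i + 1), f y| ≤
        (f (x (i + 1)) - f (x i)) * (ε / (f b - f a + 1)) := by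
    intro i hi
    obtain ⟨h1, h2, h3⟩ := h i (Finset.mem_range.1 hi)
    have h12 := h1.trans h2
    have heq : f (ξ i) * (x (i + 1) - x i) - ∫ y in x i..x (i + 1), f y =
        ∫ y in x i..x (i + 1), (f (ξ i) - f y) := by
      rw [intervalIntegral.integral_sub (by simp) (hint _ _), intervalIntegral.integral_const,
        smul_eq_mul, mul_comm]
    rw [heq, ← Real.norm_eq_abs]
    refine (intervalIntegral.norm_integral_le_of_norm_le_const
      (C := f (x (i + 1)) - f (x i)) fun y hy => ?_).trans ?_
    · rw [Set.uIoc_of_le h12] at hy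
      have hy1 := hf hy.1.le
      have hy2 := hf hy.2
      have hx1 := hf h1
      have hx2 := hf h2
      rw [Real.norm_eq_abs, abs_le]
      constructor <;> linarith
    · rw [abs_of_nonneg (by linarith)]
      exact mul_le_mul_of_nonneg_left h3.le (sub_nonneg.2 (hf h12))
  calc |∑ i ∈ Finset.range n, f (ξ i) * (x (i + 1) - x i) - ∫ y in a..b, f y|
      = |∑ i ∈ Finset.range n,
          (f (ξ i) * (x (i + 1) - x i) - ∫ y in x i..x (i + 1), f y)| := by
        rw [hsum, Finset.sum_sub_distrib]
    _ ≤ ∑ i ∈ Finset.range n, (f (x (i + 1)) - f (x i)) * (ε / (f b - f a + 1)) :=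
        (Finset.abs_sum_le_sum_abs _ _).trans (Finset.sum_le_sum hstep)
    _ = (f b - f a) * (ε / (f b - f a + 1)) := by
        rw [← Finset.sum_mul, Finset.sum_range_sub fun i => f (x i), h0, hn]
    _ < ε := by
        rw [← mul_div_assoc, div_lt_iff₀ (by positivity)]
        nlinarith

theorem HasRiemannIntegral.sub {f g : ℝ → ℝ} {a b I J : ℝ} (hf : HasRiemannIntegral f a b I)
    (hg : HasRiemannIntegral g a b J) :
    HasRiemannIntegral (fun s => f s - g s) a b (I - J) := by
  refine ⟨hf.1, fun ε hε => ?_⟩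
  obtain ⟨δ, hδ, h1⟩ := hf.2 (ε / 2) (by positivity)
  obtain ⟨η, hη, h2⟩ := hg.2 (ε / 2) (by positivity)
  refine ⟨min δ η, lt_min hδ hη, fun n x ξ h0 hn h => ?_⟩
  have k1 := h1 n x ξ h0 hn fun i hi =>
    ⟨(h i hi).1, (h i hi).2.1, (h i hi).2.2.trans_le (min_le_left _ _)⟩
  have k2 := h2 n x ξ h0 hn fun i hi =>
    ⟨(h i hi).1, (h i hi).2.1, (h i hi).2.2.trans_le (min_le_right _ _)⟩
  simp only [sub_mul, Finset.sum_sub_distrib]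
  rw [abs_lt] at k1 k2 ⊢
  constructor <;> linarith

/-- The sums over the uniform partitions, tagged at the right end points, tend to the Riemann
integral. -/
theorem HasRiemannIntegral.tendsto_uniform {f : ℝ → ℝ} {t I : ℝ}
    (hf : HasRiemannIntegral f 0 t I) :
    Tendsto (fun m : ℕ => ∑ i ∈ Finset.range (m + 1),
      f (t * (i + 1) / (m + 1)) * (t / (m + 1))) atTop (𝓝 I) := by
  have ht := hf.1
  rw [Metric.tendsto_atTop]
  intro ε hε
  obtain ⟨δ, hδ, h⟩ := hf.2 ε hε
  obtain ⟨M, hM⟩ := exists_nat_gt (t / δ)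
  refine ⟨M, fun m hm => ?_⟩
  have hm0 : (0 : ℝ) < m + 1 := by positivity
  have hlen : ∀ i : ℕ, t * ((i + 1 : ℕ) : ℝ) / (m + 1) - t * i / (m + 1) = t / (m + 1) := by
    intro i
    push_cast
    ring
  have hm' : t / (m + 1) < δ := by
    rw [div_lt_iff₀ hδ] at hM
    rw [div_lt_iff₀ hm0]
    have : (M : ℝ) ≤ m := by exact_mod_cast hm
    nlinarith
  have key := h (m + 1) (fun i => t * i / (m + 1)) (fun i => t * ((i + 1 : ℕ) : ℝ) / (m + 1))
    (by simp) (by push_cast; field_simp) fun i _ => by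
      refine ⟨?_, le_rfl, ?_⟩
      · have := hlen i
        have : 0 ≤ t / (m + 1) := by positivity
        linarith
      · simpa only [hlen] using hm'
  simp only [hlen] at key
  rw [Real.dist_eq]
  push_cast at key
  exact key

/-- The sums over the uniform partitions, tagged at the left end points, of a continuous function
tend to its integral. -/
theorem tendsto_sum_uniform_of_continuous {g : ℝ → ℂ} (hg : Continuous g) {t : ℝ} (ht : 0 ≤ t) :
    Tendsto (fun m : ℕ => ∑ i ∈ Finset.range (m + 1), ((t / (m + 1) : ℝ) : ℂ) * g (t * i / (m + 1)))
      atTop (𝓝 (∫ s in (0 : ℝ)..t, g s)) := by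
  rw [Metric.tendsto_atTop]
  intro ε hε
  have huc : UniformContinuousOn g (Set.Icc 0 t) :=
    isCompact_Icc.uniformContinuousOn_of_continuous hg.continuousOn
  rw [Metric.uniformContinuousOn_iff] at huc
  -- The total error is at most `ε * t / (t + 1)`, which is below `ε` even when `t = 0`.
  obtain ⟨δ, hδ, h⟩ := huc (ε / (t + 1)) (by positivity)
  obtain ⟨M, hM⟩ := exists_nat_gt (t / δ)
  refine ⟨M, fun m hm => ?_⟩
  have hm0 : (0 : ℝ) < m + 1 := by positivity
  have hm' : t / (m + 1) < δ := by
    rw [div_lt_iff₀ hδ] at hM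
    rw [div_lt_iff₀ hm0]
    have : (M : ℝ) ≤ m := by exact_mod_cast hm
    nlinarith
  have htm : 0 ≤ t / (m + 1) := by positivity
  set x : ℕ → ℝ := fun i => t * i / (m + 1) with hx
  have hlen : ∀ i : ℕ, x (i + 1) - x i = t / (m + 1) := by
    intro i
    simp only [hx]
    push_cast
    ring
  have hx0 : x 0 = 0 := by simp [hx]
  have hxm : x (m + 1) = t := by simp only [hx]; push_cast; field_simp
  have hsum : ∫ y in (0 : ℝ)..t, g y =
      ∑ i ∈ Finset.range (m + 1), ∫ y in x i..x (i + 1), g y := by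
    rw [intervalIntegral.sum_integral_adjacent_intervals
      fun k _ => hg.intervalIntegrable _ _, hx0, hxm]
  have hmem : ∀ i ≤ m + 1, 0 ≤ x i ∧ x i ≤ t := by
    intro i hi
    refine ⟨by positivity, ?_⟩
    have : (i : ℝ) ≤ m + 1 := by exact_mod_cast hi
    rw [hx, div_le_iff₀ hm0]
    exact mul_le_mul_of_nonneg_left this ht
  have hstep : ∀ i ∈ Finset.range (m + 1),
      ‖((t / (m + 1) : ℝ) : ℂ) * g (x i) - ∫ y in x i..x (i + 1), g y‖ ≤
        ε / (t + 1) * (t / (m + 1)) := by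
    intro i hi
    have hi' := Finset.mem_range.1 hi
    have heq : ((t / (m + 1) : ℝ) : ℂ) * g (x i) - ∫ y in x i..x (i + 1), g y =
        ∫ y in x i..x (i + 1), (g (x i) - g y) := by
      rw [intervalIntegral.integral_sub (by simp) (hg.intervalIntegrable _ _),
        intervalIntegral.integral_const, hlen, Complex.real_smul]
    rw [heq]
    have hle : x i ≤ x (i + 1) := by linarith [hlen i]
    refine (intervalIntegral.norm_integral_le_of_norm_le_const
      (C := ε / (t + 1)) fun y hy => ?_).trans ?_
    · rw [Set.uIoc_of_le hle] at hy
      have a1 := hmem i (by omega)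
      have a2 := hmem (i + 1) (by omega)
      rw [← dist_eq_norm]
      refine (h _ a1 _ ⟨by linarith [hy.1], by linarith [hy.2]⟩ ?_).le
      rw [Real.dist_eq, abs_lt]
      constructor <;> linarith [hy.1, hy.2, hlen i]
    · rw [hlen, abs_of_nonneg htm]
  rw [dist_eq_norm, hsum, ← Finset.sum_sub_distrib]
  calc _ ≤ ∑ i ∈ Finset.range (m + 1), ε / (t + 1) * (t / (m + 1)) :=
        (norm_sum_le _ _).trans (Finset.sum_le_sum hstep)
    _ = ε * t / (t + 1) := by
        rw [Finset.sum_const, Finset.card_range, nsmul_eq_mul]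
        push_cast
        field_simp
    _ < ε := by
        rw [div_lt_iff₀ (by positivity)]
        nlinarith

/-! ### Expectations under independence -/

/-- The probability generating function of the Poisson law. -/
theorem integral_pow_poissonMeasure (r : ℝ≥0) (z : ℂ) :
    ∫ n, z ^ n ∂(poissonMeasure r) = Complex.exp (r * (z - 1)) := by
  rw [integral_poissonMeasure]
  have h : ∀ n : ℕ, (Real.exp (-r) * (r : ℝ) ^ n / (n.factorial : ℝ)) • z ^ n =
      Complex.exp (-r) * (((r : ℂ) * z) ^ n / (n.factorial : ℂ)) := by
    intro n
    rw [Complex.real_smul]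
    push_cast
    rw [mul_pow]
    ring
  simp_rw [h]
  rw [tsum_mul_left, (NormedSpace.expSeries_div_hasSum_exp ((r : ℂ) * z)).tsum_eq,
    ← Complex.exp_eq_exp_ℂ, ← Complex.exp_add]
  congr 1
  ring

/-- Fubini's theorem for two independent random variables. -/
theorem ProbabilityTheory.IndepFun.integral_eq_integral_integral {Ω α β : Type*}
    [MeasurableSpace Ω] [MeasurableSpace α] [MeasurableSpace β] {P : Measure Ω}
    [IsProbabilityMeasure P] {S : Ω → α} {T : Ω → β} (h : IndepFun S T P) (hS : Measurable S)
    (hT : Measurable T) {f : α × β → ℂ} (hf : Measurable f) {C : ℝ} (hC : ∀ p, ‖f p‖ ≤ C) :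
    ∫ ω, f (S ω, T ω) ∂P = ∫ ω, ∫ ω', f (S ω, T ω') ∂P ∂P := by
  have := Measure.isProbabilityMeasure_map (μ := P) hS.aemeasurable
  have := Measure.isProbabilityMeasure_map (μ := P) hT.aemeasurable
  rw [← integral_map (φ := fun ω => (S ω, T ω)) (f := f) (hS.prodMk hT).aemeasurable
    hf.aestronglyMeasurable,
    h.map_prod_eq_prod_map_map hS.aemeasurable hT.aemeasurable, integral_prod,
    integral_map hS.aemeasurable]
  · congr 1 with ω
    exact integral_map hT.aemeasurable
      (hf.comp measurable_prodMk_left).aestronglyMeasurable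
  · exact (hf.stronglyMeasurable.integral_prod_right').aestronglyMeasurable
  · exact Integrable.of_bound hf.aestronglyMeasurable C (.of_forall hC)

/-- The expectation of a product of functions of the terms of an i.i.d. sequence. -/
theorem integral_prod_comp_of_iid {Ω α : Type*} [MeasurableSpace Ω] [MeasurableSpace α]
    {P : Measure Ω} {X : ℕ → Ω → α} (hX : ∀ k, Measurable (X k)) (hX_indep : iIndepFun X P)
    (hX_ident : ∀ i j, IdentDistrib (X i) (X j) P P) {g : ℕ → α → ℂ} (hg : ∀ k, Measurable (g k))
    (s : Finset ℕ) :
    ∫ ω, ∏ k ∈ s, g k (X k ω) ∂P = ∏ k ∈ s, ∫ ω, g k (X 0 ω) ∂P := by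
  have h := iIndepFun.integral_fun_prod_comp
    (hX_indep.precomp (g := fun i : s => (i : ℕ)) Subtype.val_injective) (fun i => (hX i).aemeasurable) (f := fun i : s => g i) fun i => (hg i).aestronglyMeasurable
  simp only [Finset.univ_eq_attach] at h
  rw [← Finset.prod_attach s fun k => ∫ ω, g k (X 0 ω) ∂P]
  calc ∫ ω, ∏ k ∈ s, g k (X k ω) ∂P = ∫ ω, ∏ k ∈ s.attach, g k (X k ω) ∂P := by
        congr 1 with ω
        exact (Finset.prod_attach s fun k => g k (X k ω)).symm
    _ = _ := by
        rw [h]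
        exact Finset.prod_congr rfl fun k _ => ((hX_ident k 0).comp (hg k)).integral_eq

/-! ### Paths and blocks of compound sums -/

/-- A path of a compound sum whose counting path is nondecreasing is Riemann integrable. -/
theorem hasRiemannIntegral_compoundSum {Ω : Type*} {N : ℝ≥0 → Ω → ℕ} {ω : Ω}
    (hN : Monotone fun t => N t ω) (X : ℕ → Ω → ℝ) (t : ℝ≥0) :
    HasRiemannIntegral (fun s : ℝ => compoundSum N X s.toNNReal ω) 0 t
      (∫ s in (0 : ℝ)..t, compoundSum N X s.toNNReal ω) := by
  have hmono : ∀ y : ℕ → ℝ, (∀ k, 0 ≤ y k) →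
      Monotone fun s : ℝ => ∑ k ∈ Finset.range (N s.toNNReal ω), y k := fun y hy a b hab =>
    Finset.sum_le_sum_of_subset_of_nonneg
      (Finset.range_subset_range.2 (hN (Real.toNNReal_le_toNNReal hab))) fun k _ _ => hy k
  have h1 := hmono (fun k => max (X k ω) 0) fun k => le_max_right _ _
  have h2 := hmono (fun k => max (-X k ω) 0) fun k => le_max_right _ _
  have heq : (fun s : ℝ => compoundSum N X s.toNNReal ω) = fun s : ℝ =>
      (∑ k ∈ Finset.range (N s.toNNReal ω), max (X k ω) 0) -
        ∑ k ∈ Finset.range (N s.toNNReal ω), max (-X k ω) 0 := by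
    ext s
    rw [compoundSum, ← Finset.sum_sub_distrib]
    refine Finset.sum_congr rfl fun k _ => ?_
    rcases le_total (X k ω) 0 with h | h
    · rw [max_eq_right h, max_eq_left (by linarith)]; ring
    · rw [max_eq_left h, max_eq_right (by linarith)]; ring
  rw [heq, intervalIntegral.integral_sub h1.intervalIntegrable h2.intervalIntegrable]
  exact (hasRiemannIntegral_of_monotone h1 t.2).sub (hasRiemannIntegral_of_monotone h2 t.2)

/-- The number of terms takes countably many values, so it suffices to fix it. -/
theorem measurable_sum_range : Measurable fun p : ℕ × (ℕ → ℝ) => ∑ k ∈ Finset.range p.1, p.2 k :=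
  measurable_from_prod_countable_right fun n => by
    simp only
    fun_prop

theorem measurable_compoundSum {Ω : Type*} [MeasurableSpace Ω] {N : ℝ≥0 → Ω → ℕ}
    {X : ℕ → Ω → ℝ} (hN : ∀ t, Measurable (N t)) (hX : ∀ k, Measurable (X k)) (t : ℝ≥0) :
    Measurable (compoundSum N X t) :=
  measurable_sum_range.comp ((hN t).prodMk (measurable_pi_iff.2 hX))

/-- A weighted sum of the block sums of a sequence is a weighted sum of its terms; the weights are
constant on the blocks. -/
theorem exists_weights_of_blocks (φ : ℝ → ℂ) {a : ℕ → ℕ} (ha : Monotone a) (c : ℕ → ℝ) (m : ℕ) :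
    ∃ d : ℕ → ℝ,
      (∀ x : ℕ → ℝ, ∑ j ∈ Finset.range m,
          c j * (∑ k ∈ Finset.range (a (j + 1)), x k - ∑ k ∈ Finset.range (a j), x k) =
        ∑ k ∈ Finset.Ico (a 0) (a m), d k * x k) ∧
      ∏ j ∈ Finset.range m, φ (c j) ^ (a (j + 1) - a j) =
        ∏ k ∈ Finset.Ico (a 0) (a m), φ (d k) := by
  induction m with
  | zero => exact ⟨0, by simp, by simp⟩
  | succ m ih =>
    obtain ⟨d, h1, h2⟩ := ih
    have h0m : a 0 ≤ a m := ha (Nat.zero_le m)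
    have hm : a m ≤ a (m + 1) := ha (Nat.le_succ m)
    obtain ⟨e, hlo, hhi⟩ : ∃ e : ℕ → ℝ, (∀ k ∈ Finset.Ico (a 0) (a m), e k = d k) ∧
        ∀ k ∈ Finset.Ico (a m) (a (m + 1)), e k = c m :=
      ⟨fun k => if k < a m then d k else c m, fun k hk => if_pos (Finset.mem_Ico.1 hk).2,
        fun k hk => if_neg (Finset.mem_Ico.1 hk).1.not_gt⟩
    refine ⟨e, fun x => ?_, ?_⟩
    · rw [Finset.sum_range_succ, h1, ← Finset.sum_Ico_consecutive _ h0m hm,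
        ← Finset.sum_Ico_eq_sub _ hm, Finset.mul_sum]
      congr 1
      · exact Finset.sum_congr rfl fun k hk => by rw [hlo k hk]
      · exact Finset.sum_congr rfl fun k hk => by rw [hhi k hk]
    · rw [Finset.prod_range_succ, h2, ← Finset.prod_Ico_consecutive _ h0m hm]
      congr 1
      · exact Finset.prod_congr rfl fun k hk => by rw [hlo k hk]
      · rw [Finset.prod_congr rfl fun k hk => by rw [hhi k hk], Finset.prod_const, Nat.card_Ico]

theorem charFun_map_eq_integral {Ω : Type*} [MeasurableSpace Ω] {P : Measure Ω} {X : Ω → ℝ}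
    (hX : AEMeasurable X P) (u : ℝ) :
    charFun (P.map X) u = ∫ ω, Complex.exp ((u * X ω : ℝ) * Complex.I) ∂P := by
  rw [charFun_apply_real, integral_map hX (by fun_prop)]
  push_cast
  rfl

/-! ### Characteristic functions of increments -/

section

variable {Ω : Type*} [MeasurableSpace Ω] {P : Measure Ω} {rate : ℝ≥0} {N : ℝ≥0 → Ω → ℕ}

/-- This is the conditional computation given the counting path: `a` stands for its values at the
partition points. -/
theorem integral_exp_blocks {X : ℕ → Ω → ℝ} (hX : ∀ k, Measurable (X k))
    (hX_indep : iIndepFun X P) (hX_ident : ∀ i j, IdentDistrib (X i) (X j) P P) {a : ℕ → ℕ}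
    (ha : Monotone a) (c : ℕ → ℝ) (m : ℕ) :
    ∫ ω, Complex.exp ((∑ j ∈ Finset.range m, c j * (∑ k ∈ Finset.range (a (j + 1)), X k ω -
        ∑ k ∈ Finset.range (a j), X k ω) : ℝ) * Complex.I) ∂P =
      ∏ j ∈ Finset.range m, charFun (P.map (X 0)) (c j) ^ (a (j + 1) - a j) := by
  obtain ⟨d, h1, h2⟩ := exists_weights_of_blocks (charFun (P.map (X 0))) ha c m
  rw [h2]
  simp only [charFun_map_eq_integral (hX 0).aemeasurable]
  rw [← integral_prod_comp_of_iid hX hX_indep hX_ident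
    (g := fun k x => Complex.exp ((d k * x : ℝ) * Complex.I)) fun k => by fun_prop]
  congr 1 with ω
  rw [h1 fun k => X k ω, ← Complex.exp_sum, ← Finset.sum_mul]
  push_cast
  rfl

/-- Increments have their law in `ℝ`; the floor turns them back into natural exponents for the
generating function. -/
theorem IsPoissonProcess.integral_pow_sub (hN : IsPoissonProcess N rate P) {s t : ℝ≥0}
    (hst : s ≤ t) (z : ℂ) :
    ∫ ω, z ^ ⌊(N t ω : ℝ) - N s ω⌋₊ ∂P = Complex.exp (rate * (t - s) * (z - 1)) := by
  have hz : Measurable fun x : ℝ => z ^ ⌊x⌋₊ :=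
    (measurable_from_nat (f := fun n : ℕ => z ^ n)).comp Nat.measurable_floor
  have h := (hN.law_increments s t hst).integral_comp (f := fun x : ℝ => z ^ ⌊x⌋₊)
    hz.aestronglyMeasurable
  simp only [Function.comp_def] at h
  rw [h, integral_map (by fun_prop) hz.aestronglyMeasurable]
  simp only [Nat.floor_natCast]
  rw [integral_pow_poissonMeasure]
  push_cast [NNReal.coe_sub hst]
  rfl

theorem IsPoissonProcess.integral_pow (hN : IsPoissonProcess N rate P) (t : ℝ≥0) (z : ℂ) :
    ∫ ω, z ^ N t ω ∂P = Complex.exp (rate * t * (z - 1)) := by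
  have h := hN.integral_pow_sub (zero_le (a := t)) z
  rw [NNReal.coe_zero, Complex.ofReal_zero, sub_zero] at h
  rw [← h]
  refine integral_congr_ae ?_
  filter_upwards [hN.start_zero] with ω hω
  simp [hω]

theorem IsPoissonProcess.integral_prod_pow_sub (hN : IsPoissonProcess N rate P) {s : ℕ → ℝ≥0}
    (hs : Monotone s) (z : ℕ → ℂ) (m : ℕ) :
    ∫ ω, ∏ j ∈ Finset.range m, z j ^ (N (s (j + 1)) ω - N (s j) ω) ∂P =
      ∏ j ∈ Finset.range m, Complex.exp (rate * (s (j + 1) - s j) * (z j - 1)) := by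
  have hz : ∀ j, Measurable fun x : ℝ => z j ^ ⌊x⌋₊ := fun j =>
    (measurable_from_nat (f := fun n : ℕ => z j ^ n)).comp Nat.measurable_floor
  have hmeas : ∀ j, Measurable fun ω => (N (s (j + 1)) ω : ℝ) - N (s j) ω := fun j =>
    (measurable_from_nat.comp (hN.measurable _)).sub (measurable_from_nat.comp (hN.measurable _))
  have h := iIndepFun.integral_fun_prod_comp
    ((hN.indep_increments.nat hs).precomp (g := fun i : Fin m => (i : ℕ)) Fin.val_injective)
    (fun i => (hmeas i).aemeasurable) (f := fun (i : Fin m) (x : ℝ) => z i ^ ⌊x⌋₊)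
    fun i => (hz i).aestronglyMeasurable
  simp only [Finset.prod_range]
  calc _ = ∫ ω, ∏ i : Fin m, z i ^ ⌊(N (s (i + 1)) ω : ℝ) - N (s i) ω⌋₊ ∂P := by
        congr 1 with ω
        refine Finset.prod_congr rfl fun i _ => ?_
        -- Truncated subtraction agrees with the floor of the real difference, whatever its sign.
        rw [Nat.floor_sub_natCast, Nat.floor_natCast]
    _ = _ := by
        rw [h]
        exact Finset.prod_congr rfl fun i _ => hN.integral_pow_sub (hs (Nat.le_succ _)) _

end

theorem norm_exp_ofReal_mul_I_le_one (x : ℝ) : ‖Complex.exp ((x : ℂ) * Complex.I)‖ ≤ 1 :=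
  (Complex.norm_exp_ofReal_mul_I x).le

/-- The joint characteristic function of the increments of a compound Poisson process. -/
theorem IsPoissonProcess.integral_exp_compoundSum_increments {Ω : Type*} [MeasurableSpace Ω]
    {P : Measure Ω} [IsProbabilityMeasure P] {rate : ℝ≥0} {N : ℝ≥0 → Ω → ℕ} {X : ℕ → Ω → ℝ}
    (hN : IsPoissonProcess N rate P) (hX : ∀ k, Measurable (X k))
    (hX_indep : iIndepFun X P) (hX_ident : ∀ i j, IdentDistrib (X i) (X j) P P)
    (hNX : IndepFun (fun ω t => N t ω) (fun ω k => X k ω) P) {s : ℕ → ℝ≥0} (hs : Monotone s)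
    (c : ℕ → ℝ) (m : ℕ) :
    ∫ ω, Complex.exp ((∑ j ∈ Finset.range m,
        c j * (compoundSum N X (s (j + 1)) ω - compoundSum N X (s j) ω) : ℝ) * Complex.I) ∂P =
      ∏ j ∈ Finset.range m,
        Complex.exp (rate * (s (j + 1) - s j) * (charFun (P.map (X 0)) (c j) - 1)) := by
  have hmeas : ∀ t, Measurable fun p : (ℝ≥0 → ℕ) × (ℕ → ℝ) =>
      ∑ k ∈ Finset.range (p.1 t), p.2 k := fun t => by
    have h : Measurable fun p : (ℝ≥0 → ℕ) × (ℕ → ℝ) => (p.1 t, p.2) := by fun_prop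
    exact measurable_sum_range.comp h
  have hF : Measurable fun p : (ℝ≥0 → ℕ) × (ℕ → ℝ) =>
      Complex.exp ((∑ j ∈ Finset.range m, c j * (∑ k ∈ Finset.range (p.1 (s (j + 1))), p.2 k -
        ∑ k ∈ Finset.range (p.1 (s j)), p.2 k) : ℝ) * Complex.I) := by
    fun_prop
  have h := hNX.integral_eq_integral_integral (measurable_pi_iff.2 hN.measurable)
    (measurable_pi_iff.2 hX) hF fun p => norm_exp_ofReal_mul_I_le_one _
  simp only [compoundSum]
  rw [h, ← hN.integral_prod_pow_sub hs]
  refine integral_congr_ae ?_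
  filter_upwards [hN.paths] with ω hω
  exact integral_exp_blocks hX hX_indep hX_ident (a := fun j => N (s j) ω)
    (fun i j hij => hω.1 (hs hij)) c m

/-- Abel summation: it trades values of the process, which are dependent, for its increments. -/
theorem sum_range_mul_sub_eq (z : ℕ → ℝ) (m : ℕ) :
    ∑ j ∈ Finset.range m, ((m : ℝ) - j) * (z (j + 1) - z j) =
      ∑ j ∈ Finset.range m, z (j + 1) - m * z 0 := by
  induction m with
  | zero => simp
  | succ m ih =>
    have h : ∑ j ∈ Finset.range (m + 1), (((m + 1 : ℕ) : ℝ) - j) * (z (j + 1) - z j) =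
        ∑ j ∈ Finset.range (m + 1), ((m : ℝ) - j) * (z (j + 1) - z j) +
          ∑ j ∈ Finset.range (m + 1), (z (j + 1) - z j) := by
      rw [← Finset.sum_add_distrib]
      refine Finset.sum_congr rfl fun j _ => ?_
      push_cast
      ring
    rw [h, Finset.sum_range_sub, Finset.sum_range_succ, ih, Finset.sum_range_succ]
    push_cast
    ring

/-! ### The randomly weighted sum -/

theorem measurable_prod_range :
    Measurable fun p : ℕ × (ℕ → ℂ) => ∏ k ∈ Finset.range p.1, p.2 k :=
  measurable_from_prod_countable_right fun n => by
    simp only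
    fun_prop

/-- The characteristic function of a compound sum that is stopped at a Poisson time and whose terms
carry independent weights. -/
theorem IsPoissonProcess.integral_exp_compoundSum_mul {Ω : Type*} [MeasurableSpace Ω]
    {P : Measure Ω} [IsProbabilityMeasure P] {rate : ℝ≥0} {N : ℝ≥0 → Ω → ℕ} {X U : ℕ → Ω → ℝ}
    (hN : IsPoissonProcess N rate P) (hX : ∀ k, Measurable (X k))
    (hX_indep : iIndepFun X P) (hX_ident : ∀ i j, IdentDistrib (X i) (X j) P P)
    (hNX : IndepFun (fun ω t => N t ω) (fun ω k => X k ω) P)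
    (hU : ∀ k, Measurable (U k)) (hU_indep : iIndepFun U P)
    (hU_ident : ∀ i j, IdentDistrib (U i) (U j) P P)
    (hNXU : IndepFun (fun ω => ((fun t => N t ω), (fun k => X k ω))) (fun ω k => U k ω) P)
    (t : ℝ≥0) (v : ℝ) :
    ∫ ω, Complex.exp ((v * compoundSum N (fun k ω' => X k ω' * U k ω') t ω : ℝ) * Complex.I) ∂P =
      Complex.exp (rate * t * (∫ ω, charFun (P.map (X 0)) (v * U 0 ω) ∂P - 1)) := by
  set ψ := charFun (P.map (U 0)) with hψ
  have := Measure.isProbabilityMeasure_map (μ := P) (hU 0).aemeasurable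
  have hψm : Measurable ψ := measurable_charFun
  have hF : Measurable fun p : ((ℝ≥0 → ℕ) × (ℕ → ℝ)) × (ℕ → ℝ) =>
      Complex.exp ((v * ∑ k ∈ Finset.range (p.1.1 t), p.1.2 k * p.2 k : ℝ) * Complex.I) := by
    have h1 : Measurable fun p : ((ℝ≥0 → ℕ) × (ℕ → ℝ)) × (ℕ → ℝ) =>
        (p.1.1 t, fun k => p.1.2 k * p.2 k) := by fun_prop
    have h2 := measurable_sum_range.comp h1
    simp only [Function.comp_def] at h2
    fun_prop
  have hG : Measurable fun p : (ℝ≥0 → ℕ) × (ℕ → ℝ) =>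
      ∏ k ∈ Finset.range (p.1 t), ψ (v * p.2 k) := by
    have h1 : Measurable fun p : (ℝ≥0 → ℕ) × (ℕ → ℝ) => (p.1 t, fun k => ψ (v * p.2 k)) := by
      fun_prop
    have h2 := measurable_prod_range.comp h1
    simpa only [Function.comp_def] using h2
  have hGb : ∀ p : (ℝ≥0 → ℕ) × (ℕ → ℝ), ‖∏ k ∈ Finset.range (p.1 t), ψ (v * p.2 k)‖ ≤ 1 := by
    intro p
    rw [norm_prod]
    exact Finset.prod_le_one (fun _ _ => norm_nonneg _) fun _ _ => norm_charFun_le_one _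
  have hNm : Measurable fun ω t => N t ω := measurable_pi_iff.2 hN.measurable
  have hXm : Measurable fun ω k => X k ω := measurable_pi_iff.2 hX
  have hUm : Measurable fun ω k => U k ω := measurable_pi_iff.2 hU
  have h1 := hNXU.integral_eq_integral_integral (hNm.prodMk hXm) hUm hF
    fun p => norm_exp_ofReal_mul_I_le_one _
  have h2 := hNX.integral_eq_integral_integral hNm hXm hG hGb
  -- Integrate out `U` with the number of terms and the jumps frozen.
  have hinner : ∀ (n : ℕ) (x : ℕ → ℝ), ∫ ω, Complex.exp
      ((v * ∑ k ∈ Finset.range n, x k * U k ω : ℝ) * Complex.I) ∂P =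
        ∏ k ∈ Finset.range n, ψ (v * x k) := by
    intro n x
    simp only [hψ, charFun_map_eq_integral (hU 0).aemeasurable]
    rw [← integral_prod_comp_of_iid hU hU_indep hU_ident
      (g := fun k y => Complex.exp ((v * x k * y : ℝ) * Complex.I)) fun k => by fun_prop]
    congr 1 with ω
    rw [← Complex.exp_sum, ← Finset.sum_mul, Finset.mul_sum]
    push_cast
    simp only [mul_assoc]
  have hinner' : ∀ n : ℕ, ∫ ω, ∏ k ∈ Finset.range n, ψ (v * X k ω) ∂P =
      (∫ ω, ψ (v * X 0 ω) ∂P) ^ n := by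
    intro n
    rw [integral_prod_comp_of_iid hX hX_indep hX_ident (g := fun _ y => ψ (v * y))
      fun k => by fun_prop, Finset.prod_const, Finset.card_range]
  -- Both sides are the double integral of `exp(i v X₀(ω) U₀(ω'))`, in the two orders.
  have hswap : ∫ ω, ψ (v * X 0 ω) ∂P = ∫ ω, charFun (P.map (X 0)) (v * U 0 ω) ∂P := by
    simp only [hψ, charFun_map_eq_integral (hU 0).aemeasurable,
      charFun_map_eq_integral (hX 0).aemeasurable]
    rw [integral_integral_swap]
    · congr 1 with ω
      congr 1 with ω'
      rw [mul_right_comm]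
    · refine Integrable.of_bound (C := 1) ?_ (.of_forall fun p => norm_exp_ofReal_mul_I_le_one _)
      have := hX 0
      have := hU 0
      simp only [Function.uncurry_def]
      exact Measurable.aestronglyMeasurable (by fun_prop)
  simp only [compoundSum]
  rw [h1]
  simp only [hinner]
  rw [h2]
  simp only [hinner']
  rw [hN.integral_pow, hswap]

/-! ### The integral as a limit of Riemann sums -/

/-- The integral of a compound Poisson process is almost surely the limit of its Riemann sums. -/
theorem IsPoissonProcess.ae_tendsto_riemannSum {Ω : Type*} [MeasurableSpace Ω]
    {P : Measure Ω} {rate : ℝ≥0} {N : ℝ≥0 → Ω → ℕ} (hN : IsPoissonProcess N rate P)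
    (X : ℕ → Ω → ℝ) (t : ℝ≥0) :
    ∀ᵐ ω ∂P, Tendsto (fun m : ℕ => ∑ j ∈ Finset.range (m + 1),
        compoundSum N X ((t : ℝ) * (j + 1) / (m + 1)).toNNReal ω * (t / (m + 1))) atTop
      (𝓝 (∫ s in (0 : ℝ)..t, compoundSum N X s.toNNReal ω)) := by
  filter_upwards [hN.paths] with ω hω
  exact (hasRiemannIntegral_compoundSum hω.1 X t).tendsto_uniform

theorem IsPoissonProcess.aemeasurable_integral_compoundSum {Ω : Type*} [MeasurableSpace Ω]
    {P : Measure Ω} {rate : ℝ≥0} {N : ℝ≥0 → Ω → ℕ} {X : ℕ → Ω → ℝ}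
    (hN : IsPoissonProcess N rate P) (hX : ∀ k, Measurable (X k)) (t : ℝ≥0) :
    AEMeasurable (fun ω => ∫ s in (0 : ℝ)..t, compoundSum N X s.toNNReal ω) P :=
  aemeasurable_of_tendsto_metrizable_ae atTop (fun _ => (Finset.measurable_fun_sum _ fun _ _ =>
    (measurable_compoundSum hN.measurable hX _).mul_const _).aemeasurable)
    (hN.ae_tendsto_riemannSum X t)

/-- The characteristic function of a Riemann sum of a compound Poisson process. -/
theorem IsPoissonProcess.integral_exp_riemannSum {Ω : Type*} [MeasurableSpace Ω]
    {P : Measure Ω} [IsProbabilityMeasure P] {rate : ℝ≥0} {N : ℝ≥0 → Ω → ℕ} {X : ℕ → Ω → ℝ}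
    (hN : IsPoissonProcess N rate P) (hX : ∀ k, Measurable (X k))
    (hX_indep : iIndepFun X P) (hX_ident : ∀ i j, IdentDistrib (X i) (X j) P P)
    (hNX : IndepFun (fun ω t => N t ω) (fun ω k => X k ω) P) (t : ℝ≥0) (u : ℝ) (m : ℕ) :
    ∫ ω, Complex.exp ((u * ∑ j ∈ Finset.range (m + 1),
        compoundSum N X ((t : ℝ) * (j + 1) / (m + 1)).toNNReal ω * (t / (m + 1)) : ℝ) * Complex.I) ∂P =
      Complex.exp (rate * ∑ j ∈ Finset.range (m + 1), ((t / (m + 1) : ℝ) : ℂ) *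
        (charFun (P.map (X 0)) (u * (t - t * j / (m + 1))) - 1)) := by
  set s : ℕ → ℝ≥0 := fun j => t * j / (m + 1) with hs
  have hs_mono : Monotone s := fun i j hij => by
    simp only [hs]
    gcongr
  have hs_coe : ∀ j, (s j : ℝ) = t * j / (m + 1) := fun j => by simp [hs]
  have hm0 : (m : ℝ) + 1 ≠ 0 := by positivity
  have hs_succ : ∀ j : ℕ, ((t : ℝ) * (j + 1) / (m + 1)).toNNReal = s (j + 1) := fun j => by
    rw [← Real.toNNReal_coe (r := s (j + 1)), hs_coe]
    push_cast
    rfl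
  have h := hN.integral_exp_compoundSum_increments hX hX_indep hX_ident hNX hs_mono
    (fun j => u * (t - t * j / (m + 1))) (m + 1)
  simp only [hs_succ]
  calc _ = ∫ ω, Complex.exp ((∑ j ∈ Finset.range (m + 1), u * (t - t * j / (m + 1)) *
        (compoundSum N X (s (j + 1)) ω - compoundSum N X (s j) ω) : ℝ) * Complex.I) ∂P := by
        refine integral_congr_ae ?_
        filter_upwards [hN.start_zero] with ω hω
        -- This removes the boundary term of the Abel summation.
        have h0 : compoundSum N X (s 0) ω = 0 := by simp [hs, compoundSum, hω]
        have hab := sum_range_mul_sub_eq (fun j => compoundSum N X (s j) ω) (m + 1)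
        rw [h0, mul_zero, sub_zero] at hab
        rw [← Finset.sum_mul, ← hab, Finset.sum_mul, Finset.mul_sum]
        congr 3
        refine Finset.sum_congr rfl fun j _ => ?_
        push_cast
        field_simp
    _ = _ := by
        rw [h, ← Complex.exp_sum, Finset.mul_sum]
        congr 1
        refine Finset.sum_congr rfl fun j _ => ?_
        have h1 : ((s (j + 1) : ℝ) : ℂ) - (s j : ℝ) = ((t / (m + 1) : ℝ) : ℂ) := by
          rw [hs_coe, hs_coe, ← Complex.ofReal_sub]
          congr 1
          push_cast
          ring
        rw [h1, mul_assoc]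

/-- The characteristic function of the integral of a compound Poisson process. -/
theorem IsPoissonProcess.integral_exp_integral_compoundSum {Ω : Type*} [MeasurableSpace Ω]
    {P : Measure Ω} [IsProbabilityMeasure P] {rate : ℝ≥0} {N : ℝ≥0 → Ω → ℕ} {X : ℕ → Ω → ℝ}
    (hN : IsPoissonProcess N rate P) (hX : ∀ k, Measurable (X k))
    (hX_indep : iIndepFun X P) (hX_ident : ∀ i j, IdentDistrib (X i) (X j) P P)
    (hNX : IndepFun (fun ω t => N t ω) (fun ω k => X k ω) P) (t : ℝ≥0) (u : ℝ) :
    ∫ ω, Complex.exp ((u * ∫ s in (0 : ℝ)..t, compoundSum N X s.toNNReal ω : ℝ) *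
        Complex.I) ∂P =
      Complex.exp (rate * ∫ s in (0 : ℝ)..t, (charFun (P.map (X 0)) (u * (t - s)) - 1)) := by
  have := Measure.isProbabilityMeasure_map (μ := P) (hX 0).aemeasurable
  have hφ : Continuous (charFun (P.map (X 0))) := continuous_charFun
  have hleft : Tendsto (fun m : ℕ => ∫ ω, Complex.exp ((u * ∑ j ∈ Finset.range (m + 1),
      compoundSum N X ((t : ℝ) * (j + 1) / (m + 1)).toNNReal ω * (t / (m + 1)) : ℝ) * Complex.I) ∂P)
      atTop (𝓝 (∫ ω, Complex.exp ((u * ∫ s in (0 : ℝ)..t, compoundSum N X s.toNNReal ω : ℝ) *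
        Complex.I) ∂P)) := by
    refine tendsto_integral_of_dominated_convergence (fun _ => 1) (fun m => ?_)
      (integrable_const _) (fun m => .of_forall fun ω => norm_exp_ofReal_mul_I_le_one _) ?_
    · have := measurable_compoundSum hN.measurable hX
      exact Measurable.aestronglyMeasurable (by fun_prop)
    · filter_upwards [hN.ae_tendsto_riemannSum X t] with ω hω
      have hc : Continuous fun y : ℝ => Complex.exp ((u * y : ℝ) * Complex.I) := by fun_prop
      exact (hc.tendsto _).comp hω
  refine tendsto_nhds_unique hleft ?_
  simp only [hN.integral_exp_riemannSum hX hX_indep hX_ident hNX t u]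
  have hr := tendsto_sum_uniform_of_continuous
    (g := fun s => charFun (P.map (X 0)) (u * (t - s)) - 1) (by fun_prop) t.2
  exact (Complex.continuous_exp.tendsto _).comp (hr.const_mul _)

/-! ### Comparison of the two laws -/

theorem ProbabilityTheory.integral_comp_of_isUniform_Ioo {Ω : Type*} [MeasurableSpace Ω]
    {P : Measure Ω} {V : Ω → ℝ} (hV : Measurable V)
    (h : pdf.IsUniform V (Set.Ioo (0 : ℝ) 1) P volume) {f : ℝ → ℂ} (hf : Measurable f) :
    ∫ ω, f (V ω) ∂P = ∫ v in (0 : ℝ)..1, f v := by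
  rw [← integral_map hV.aemeasurable hf.aestronglyMeasurable, h, ProbabilityTheory.cond,
    intervalIntegral.integral_of_le zero_le_one, integral_Ioc_eq_integral_Ioo]
  simp

end

theorem mainTheorem11 {Ω : Type*} [MeasurableSpace Ω] (P : Measure Ω) [IsProbabilityMeasure P]
    (rate : ℝ≥0) (hrate : 0 < rate)
    (N : ℝ≥0 → Ω → ℕ) (X U : ℕ → Ω → ℝ)
    (hN : IsPoissonProcess N rate P)
    -- the jumps are i.i.d. and the sequence of jumps is independent of the Poisson process
    (hX : ∀ k, Measurable (X k))
    (hX_indep : iIndepFun X P)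
    (hX_ident : ∀ i j, IdentDistrib (X i) (X j) P P)
    (hNX : IndepFun (fun ω t => N t ω) (fun ω k => X k ω) P)
    -- the `U k` are i.i.d. uniform on `(0, 1)` and independent of the pair `(N, X)`
    (hU : ∀ k, Measurable (U k))
    (hU_indep : iIndepFun U P)
    (hU_unif : ∀ k, pdf.IsUniform (U k) (Set.Ioo (0 : ℝ) 1) P volume)
    (hNXU : IndepFun (fun ω => ((fun t => N t ω), (fun k => X k ω))) (fun ω k => U k ω) P) :
    (∀ᵐ ω ∂P, ∀ t : ℝ≥0,
      HasRiemannIntegral (fun s : ℝ => compoundSum N X s.toNNReal ω) 0 t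
        (∫ s in (0 : ℝ)..t, compoundSum N X s.toNNReal ω)) ∧
    ∀ t : ℝ≥0,
      IdentDistrib (fun ω => ∫ s in (0 : ℝ)..t, compoundSum N X s.toNNReal ω)
        (fun ω => (t : ℝ) * compoundSum N (fun k ω' => X k ω' * U k ω') t ω) P P := by
  refine ⟨?_, fun t => ?_⟩
  -- The exceptional null set comes from the paths of `N` alone, so it serves all `t` at once.
  · filter_upwards [hN.paths] with ω hω t
    exact hasRiemannIntegral_compoundSum hω.1 X t
  have hY := hN.aemeasurable_integral_compoundSum hX t
  have hW : AEMeasurable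
      (fun ω => (t : ℝ) * compoundSum N (fun k ω' => X k ω' * U k ω') t ω) P :=
    ((measurable_compoundSum hN.measurable (fun k => (hX k).mul (hU k)) t).const_mul _).aemeasurable
  have hU_ident : ∀ i j, IdentDistrib (U i) (U j) P P := fun i j =>
    ⟨(hU i).aemeasurable, (hU j).aemeasurable, (hU_unif i).trans (hU_unif j).symm⟩
  refine ⟨hY, hW, ?_⟩
  have := Measure.isProbabilityMeasure_map hY
  have := Measure.isProbabilityMeasure_map hW
  have := Measure.isProbabilityMeasure_map (μ := P) (hX 0).aemeasurable
  have hφ : Continuous (charFun (P.map (X 0))) := continuous_charFun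
  refine Measure.ext_of_charFun (funext fun u => ?_)
  rw [charFun_map_eq_integral hY, charFun_map_eq_integral hW,
    hN.integral_exp_integral_compoundSum hX hX_indep hX_ident hNX]
  -- Regroups `u * (t * S)` as `(u * t) * S`, so that the next formula applies at the argument `u *
  -- t`.
  simp only [← mul_assoc]
  rw [hN.integral_exp_compoundSum_mul hX hX_indep hX_ident hNX hU hU_indep hU_ident hNXU,
    integral_comp_of_isUniform_Ioo (hU 0) (hU_unif 0)
      (f := fun v => charFun (P.map (X 0)) (u * t * v)) (by fun_prop), mul_assoc]
  congr 2
  have h1 : ∫ s in (0 : ℝ)..t, charFun (P.map (X 0)) (u * (t - s)) =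
      t * ∫ v in (0 : ℝ)..1, charFun (P.map (X 0)) (u * t * v) := by
    rw [intervalIntegral.integral_comp_sub_left fun s => charFun (P.map (X 0)) (u * s)]
    -- This form of the scaling rule needs no division by `t`, so `t = 0` is included.
    have h2 := intervalIntegral.smul_integral_comp_mul_left (a := 0) (b := 1)
      (fun s => charFun (P.map (X 0)) (u * s)) (t : ℝ)
    rw [Complex.real_smul, mul_zero, mul_one] at h2
    simp only [sub_self, sub_zero, mul_assoc, ← h2]
  rw [intervalIntegral.integral_sub
    (Continuous.intervalIntegrable (by fun_prop) _ _) (by simp), h1,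
    intervalIntegral.integral_const, Complex.real_smul]
  push_cast
  ring
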